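/- Let $K\ge 2$ be an integer, $R>0$, $\theta>0$ real, and $d_1>d_2>\dots>d_K>0$. Let $\mathcal S_K=\{x\in\mathbb R^K:\ \sum_{i=1}^K 2^{R(i-1)}x_i=1,\ x_j\ge 0 \text{ for all } j\}$, let $g(x)=e^{-\theta/x}$ for $x>0$ and $g(0)=0$, and consider the problem of maximizing $G(x)=\sum_{i=1}^K g(x_i)d_i$ over $x\in\mathcal S_K$. Let $W_0:[-1/e,0)\to[-1,0)$ and $W_{-1}:[-1/e,0)\to(-\infty,-1]$ be the two real branches of the inverse of $w\mapsto we^w$. Put $c_i(\lambda)=\lambda\theta 2^{R(i-1)}/d_i$, $x_i^-(\lambda)=\theta/\bigl(-2W_0(-\tfrac12\sqrt{c_i(\lambda)})\bigr)$, $x_i^+(\lambda)=\theta/\bigl(-2W_{-1}(-\tfrac12\sqrt{c_i(\lambda)})\bigr)$, $H_\ell^-(\lambda)=\sum_{i=1}^{\ell}2^{R(i-1)}x_i^-(\lambda)$, $H_\ell^+(\lambda)=2^{R(\ell-1)}x_\ell^+(\lambda)+\sum_{i=1}^{\ell-1}2^{R(i-1)}x_i^-(\lambda)$, $\lambda_{\min}=d_1\theta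 e^{-\theta}$, $\lambda_{\max}(\ell)=4e^{-2}d_\ell/(\theta 2^{R(\ell-1)})$, and let $\ell_{\rm PDS}=1$ if $\theta\ge 2$, and $\ell_{\rm PDS}=\max\{1\le i\le K: 2^{iR}/d_i\le (2^R/d_1)\cdot 4e^{-2}/(\theta^2e^{-\theta})\}$ if $\theta<2$. Algorithm (exact arithmetic, exact root finding). If $\theta>-2W_0\bigl(-\tfrac1e\sqrt{d_2/(2^Rd_1)}\bigr)$, return $(1,0,\dots,0)$. Otherwise, for each $\ell\in\{2,\dots,\ell_{\rm PDS}\}$ start with $\mathcal C_\ell=\emptyset$ and do the following. (a) If $H_\ell^-(\lambda_{\min})\ge 1\ge H_\ell^-(\lambda_{\max}(\ell))$, find the unique $\lambda^-\in[\lambda_{\min},\lambda_{\max}(\ell)]$ with $H_\ell^-(\lambda^-)=1$ and add $(x_1^-(\lambda^-),\dots,x_\ell^-(\lambda^-),0,\dots,0)$ to $\mathcal C_\ell$. (b) If $H_\ell^-(\lambda_{\min})\ge 1$, find all roots $\lambda^+$ of $H_\ell^+(\lambda)=1$ in $[\lambda_{\min},\lambda_{\max}(\ell)]$ and add to $\mathcal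 C_\ell$, for each of them, the vector $(x_1^-(\lambda^+),\dots,x_{\ell-1}^-(\lambda^+),x_\ell^+(\lambda^+),0,\dots,0)$. (c) If $\mathcal C_\ell=\emptyset$ let $x^{(\ell)}=(0,\dots,0)$; otherwise let $x^{(\ell)}$ be an element of $\mathcal C_\ell$ with largest value of $G$. Finally set $x^{(1)}=(1,0,\dots,0)$ and return some $x^{(\ell)}$, $1\le\ell\le\ell_{\rm PDS}$, with largest value of $G$. Ties are broken arbitrarily. Theorem. (1) The algorithm is well defined: the argument of $W_0$ in the initial test lies in $[-1/e,0)$; for every $2\le\ell\le\ell_{\rm PDS}$ one has $\lambda_{\min}\le\lambda_{\max}(\ell)$ and $-\tfrac1e\le-\tfrac12\sqrt{c_i(\lambda)}<0$ for all $i\le\ell$ and $\lambda\in[\lambda_{\min},\lambda_{\max}(\ell)]$; the root $\lambda^-$ in (a) exists and is unique whenever the condition in (a) holds; and $H_\ell^+(\lambda)=1$ has only finitely many roots in $[\lambda_{\min},\lambda_{\max}(\ell)]$. (2) The algorithm has an output, and every output is a global maximizer of $G$ over $\mathcal S_K$. (3) Every global maximizer $x^\star$ of $G$ over $\mathcal S_K$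 is either $(1,0,\dots,0)$ or there are $2\le\ell\le\ell_{\rm PDS}$ and $\lambda\in[\lambda_{\min},\lambda_{\max}(\ell)]$ such that $x_i^\star=x_i^-(\lambda)$ for $i<\ell$, $x_\ell^\star\in\{x_\ell^-(\lambda),x_\ell^+(\lambda)\}$, $x_i^\star=0$ for $i>\ell$, and $\sum_{i=1}^\ell 2^{R(i-1)}x_i^\star=1$. -/

import Mathlib

/-! Coordinates of vectors in `ℝ^K` are indexed by `Fin K`, so `d i`, `x i` with `i : Fin K` stand for
`d_{i+1}`, `x_{i+1}`, and the weight `2^{R(j-1)}` of the coordinate `j = i + 1` is `2^(R * i)`.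
A last active layer `l : Fin K` stands for the number `ℓ = l + 1` of active layers. -/

namespace PDS

noncomputable section

/-- Principal real branch of the Lambert function on `[-1/e, 0)`:
`lambertW0 z` is the unique `w ∈ [-1, 0)` with `w * e^w = z`. -/
def lambertW0 (z : ℝ) : ℝ :=
  Function.invFunOn (fun w : ℝ => w * Real.exp w) (Set.Ico (-1) 0) z

/-- Secondary real branch of the Lambert function on `[-1/e, 0)`:
`lambertWm1 z` is the unique `w ∈ (-∞, -1]` with `w * e^w = z`. -/
def lambertWm1 (z : ℝ) : ℝ :=
  Function.invFunOn (fun w : ℝ => w * Real.exp w) (Set.Iic (-1)) z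

/-- `g(x) = exp (-θ / x)`, with `g(0) = 0`. -/
def g (θ x : ℝ) : ℝ := if x = 0 then 0 else Real.exp (-(θ / x))

/-- The objective `G(x) = ∑ g(x_i) d_i`. -/
def G {K : ℕ} (θ : ℝ) (d x : Fin K → ℝ) : ℝ := ∑ i, g θ (x i) * d i

/-- The feasible set `S_K`. -/
def feasible (K : ℕ) (R : ℝ) : Set (Fin K → ℝ) :=
  {x | ∑ i : Fin K, (2 : ℝ) ^ (R * (i : ℝ)) * x i = 1 ∧ ∀ i, 0 ≤ x i}

/-- `x` is a global maximizer of `G` over `S_K`. -/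
def IsGlobalMaximizer {K : ℕ} (R θ : ℝ) (d x : Fin K → ℝ) : Prop :=
  x ∈ feasible K R ∧ ∀ y ∈ feasible K R, G θ d y ≤ G θ d x

/-- The vector `(1, 0, …, 0)`. -/
def firstVec (K : ℕ) [NeZero K] : Fin K → ℝ := Pi.single 0 1

/-- `ℓ_PDS`, the upper bound on the number of active layers. -/
def ellPDS {K : ℕ} [NeZero K] (R θ : ℝ) (d : Fin K → ℝ) : ℕ :=
  open Classical in
  if 2 ≤ θ then 1
  else sSup {j : ℕ | ∃ i : Fin K, j = (i : ℕ) + 1 ∧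
    (2 : ℝ) ^ ((j : ℝ) * R) / d i ≤
      ((2 : ℝ) ^ R / d 0) * (4 * Real.exp (-2) / (θ ^ 2 * Real.exp (-θ)))}

/-- `c_i(lam) = lam θ 2^{R(i-1)} / d_i`. -/
def c {K : ℕ} (R θ : ℝ) (d : Fin K → ℝ) (i : Fin K) (lam : ℝ) : ℝ :=
  lam * θ * (2 : ℝ) ^ (R * (i : ℝ)) / d i

/-- `x_i^-(lam)`, the principal branch. -/
def xMinus {K : ℕ} (R θ : ℝ) (d : Fin K → ℝ) (i : Fin K) (lam : ℝ) : ℝ :=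
  θ / (-2 * lambertW0 (-(√(c R θ d i lam) / 2)))

/-- `x_i^+(lam)`, the secondary branch. -/
def xPlus {K : ℕ} (R θ : ℝ) (d : Fin K → ℝ) (i : Fin K) (lam : ℝ) : ℝ :=
  θ / (-2 * lambertWm1 (-(√(c R θ d i lam) / 2)))

/-- `H_ℓ^-(lam)`, `ℓ = l + 1`. -/
def HMinus {K : ℕ} (R θ : ℝ) (d : Fin K → ℝ) (l : Fin K) (lam : ℝ) : ℝ :=
  ∑ i ∈ Finset.Iic l, (2 : ℝ) ^ (R * (i : ℝ)) * xMinus R θ d i lam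

/-- `H_ℓ^+(lam)`, `ℓ = l + 1`. -/
def HPlus {K : ℕ} (R θ : ℝ) (d : Fin K → ℝ) (l : Fin K) (lam : ℝ) : ℝ :=
  (2 : ℝ) ^ (R * (l : ℝ)) * xPlus R θ d l lam +
    ∑ i ∈ Finset.Iio l, (2 : ℝ) ^ (R * (i : ℝ)) * xMinus R θ d i lam

/-- `lam_min = d_1 θ e^{-θ}`. -/
def lamMin {K : ℕ} [NeZero K] (θ : ℝ) (d : Fin K → ℝ) : ℝ := d 0 * θ * Real.exp (-θ)

/-- `lam_max(ℓ) = 4 e^{-2} d_ℓ / (θ 2^{R(ℓ-1)})`, `ℓ = l + 1`. -/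
def lamMax {K : ℕ} (R θ : ℝ) (d : Fin K → ℝ) (l : Fin K) : ℝ :=
  4 * Real.exp (-2) * d l / (θ * (2 : ℝ) ^ (R * (l : ℝ)))

/-- The candidate `(x_1^-(lam), …, x_ℓ^-(lam), 0, …, 0)`, `ℓ = l + 1`. -/
def candMinus {K : ℕ} (R θ : ℝ) (d : Fin K → ℝ) (l : Fin K) (lam : ℝ) : Fin K → ℝ :=
  fun i => if i ≤ l then xMinus R θ d i lam else 0

/-- The candidate `(x_1^-(lam), …, x_{ℓ-1}^-(lam), x_ℓ^+(lam), 0, …, 0)`, `ℓ = l + 1`. -/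
def candPlus {K : ℕ} (R θ : ℝ) (d : Fin K → ℝ) (l : Fin K) (lam : ℝ) : Fin K → ℝ :=
  fun i => if i < l then xMinus R θ d i lam else if i = l then xPlus R θ d i lam else 0

/-- The solutions `lam ∈ [lam_min, lam_max(ℓ)]` of `H_ℓ^-(lam) = 1`. -/
def rootsMinus {K : ℕ} [NeZero K] (R θ : ℝ) (d : Fin K → ℝ) (l : Fin K) : Set ℝ :=
  {lam | lam ∈ Set.Icc (lamMin θ d) (lamMax R θ d l) ∧ HMinus R θ d l lam = 1}

/-- The solutions `lam ∈ [lam_min, lam_max(ℓ)]` of `H_ℓ^+(lam) = 1`. -/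
def rootsPlus {K : ℕ} [NeZero K] (R θ : ℝ) (d : Fin K → ℝ) (l : Fin K) : Set ℝ :=
  {lam | lam ∈ Set.Icc (lamMin θ d) (lamMax R θ d l) ∧ HPlus R θ d l lam = 1}

/-- The guard `H_ℓ^-(lam_min) ≥ 1 ≥ H_ℓ^-(lam_max(ℓ))` of the principal-branch step. -/
def guardMinus {K : ℕ} [NeZero K] (R θ : ℝ) (d : Fin K → ℝ) (l : Fin K) : Prop :=
  1 ≤ HMinus R θ d l (lamMin θ d) ∧ HMinus R θ d l (lamMax R θ d l) ≤ 1

/-- The guard `H_ℓ^-(lam_min) ≥ 1` of the secondary-branch step. -/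
def guardPlus {K : ℕ} [NeZero K] (R θ : ℝ) (d : Fin K → ℝ) (l : Fin K) : Prop :=
  1 ≤ HMinus R θ d l (lamMin θ d)

/-- The candidate set `C_ℓ` built in the pass `ℓ = l + 1` of the loop. -/
def candidates {K : ℕ} [NeZero K] (R θ : ℝ) (d : Fin K → ℝ) (l : Fin K) : Set (Fin K → ℝ) :=
  {x | guardMinus R θ d l ∧ ∃ lam ∈ rootsMinus R θ d l, x = candMinus R θ d l lam} ∪
  {x | guardPlus R θ d l ∧ ∃ lam ∈ rootsPlus R θ d l, x = candPlus R θ d l lam}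

/-- `x` is a legitimate value of `x^{(ℓ)}` after the pass `ℓ = l + 1` of the loop: the zero vector
if `C_ℓ` is empty, and otherwise an element of `C_ℓ` of largest objective value (ties are broken
arbitrarily). -/
def IsLayerPoint {K : ℕ} [NeZero K] (R θ : ℝ) (d : Fin K → ℝ) (l : Fin K) (x : Fin K → ℝ) :
    Prop :=
  (candidates R θ d l = ∅ ∧ x = 0) ∨
    (x ∈ candidates R θ d l ∧ ∀ y ∈ candidates R θ d l, G θ d y ≤ G θ d x)

/-- The argument `-(1/e) √(d_2 / (2^R d_1))` of `W_0` in the initial test. -/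
def testArg {K : ℕ} [NeZero K] (R : ℝ) (d : Fin K → ℝ) : ℝ :=
  -(1 / Real.exp 1 * √(d 1 / ((2 : ℝ) ^ R * d 0)))

/-- The initial test `θ > -2 W_0(-(1/e) √(d_2 / (2^R d_1)))`. -/
def initialTest {K : ℕ} [NeZero K] (R θ : ℝ) (d : Fin K → ℝ) : Prop :=
  θ > -2 * lambertW0 (testArg R d)

/-- `x` is a possible output of the algorithm on the input `(R, θ, d)`: if the initial test
succeeds, `(1, 0, …, 0)` is returned; otherwise the points `x^{(ℓ)}`, `2 ≤ ℓ ≤ ℓ_PDS`, are computed,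
`x^{(1)}` is set to `(1, 0, …, 0)`, and some `x^{(ℓ)}`, `1 ≤ ℓ ≤ ℓ_PDS`, of largest objective value
is returned. -/
def IsAlgorithmOutput {K : ℕ} [NeZero K] (R θ : ℝ) (d x : Fin K → ℝ) : Prop :=
  (initialTest R θ d ∧ x = firstVec K) ∨
  (¬ initialTest R θ d ∧ ∃ p : Fin K → (Fin K → ℝ),
    p 0 = firstVec K ∧
    (∀ l : Fin K, 2 ≤ (l : ℕ) + 1 → (l : ℕ) + 1 ≤ ellPDS R θ d → IsLayerPoint R θ d l (p l)) ∧
    ∃ l : Fin K, (l : ℕ) + 1 ≤ ellPDS R θ d ∧ x = p l ∧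
      ∀ j : Fin K, (j : ℕ) + 1 ≤ ellPDS R θ d → G θ d (p j) ≤ G θ d (p l))

/-- All steps of the algorithm are meaningful: the initial test evaluates `W_0` inside its domain
`[-1/e, 0)`; and in each pass `ℓ = l + 1` with `2 ≤ ℓ ≤ ℓ_PDS` the search interval is nonempty, the
Lambert branches are evaluated inside `[-1/e, 0)`, the principal-branch equation has a unique root
when its guard holds, and the secondary-branch equation has only finitely many roots. -/
def AlgorithmWellDefined {K : ℕ} [NeZero K] (R θ : ℝ) (d : Fin K → ℝ) : Prop :=
  testArg R d ∈ Set.Ico (-(1 / Real.exp 1)) 0 ∧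
  ∀ l : Fin K, 2 ≤ (l : ℕ) + 1 → (l : ℕ) + 1 ≤ ellPDS R θ d →
    lamMin θ d ≤ lamMax R θ d l ∧
    (∀ lam ∈ Set.Icc (lamMin θ d) (lamMax R θ d l), ∀ i ≤ l,
      -(√(c R θ d i lam) / 2) ∈ Set.Ico (-(1 / Real.exp 1)) 0) ∧
    (guardMinus R θ d l → ∃! lam, lam ∈ rootsMinus R θ d l) ∧
    (rootsPlus R θ d l).Finite

/-- `x` has the Lambert form: for some `2 ≤ ℓ ≤ ℓ_PDS` (`ℓ = l + 1`) and some
`lam ∈ [lam_min, lam_max(ℓ)]`, the coordinates before the `ℓ`-th lie on the principal branch, the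
`ℓ`-th one lies on either branch, the later ones vanish, and `∑_{i ≤ ℓ} 2^{R(i-1)} x_i = 1`. -/
def HasLambertForm {K : ℕ} [NeZero K] (R θ : ℝ) (d x : Fin K → ℝ) : Prop :=
  ∃ l : Fin K, 2 ≤ (l : ℕ) + 1 ∧ (l : ℕ) + 1 ≤ ellPDS R θ d ∧
    ∃ lam ∈ Set.Icc (lamMin θ d) (lamMax R θ d l),
      (∀ i < l, x i = xMinus R θ d i lam) ∧
      (x l = xMinus R θ d l lam ∨ x l = xPlus R θ d l lam) ∧
      (∀ i > l, x i = 0) ∧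
      ∑ i ∈ Finset.Iic l, (2 : ℝ) ^ (R * (i : ℝ)) * x i = 1

end

end PDS

namespace PDS

open Set Filter Topology

/-! ### The function `u ↦ u e^{-u}` and its two inverse branches -/

/-! With `psi u = u e^{-u}`, the derivative of the reward is `g'(x) = (4/θ) psi(θ/(2x))^2`. Since
`psi` rises up to `u = 1` and falls afterwards, `g` is convex below `θ/2` and concave above it. A
stationary point with multiplier `lam` satisfies `psi(θ/(2 x_i)) = √c_i / 2` on its active
coordinates, and the two branches `x_i^∓` are the solutions on the concave and convex side
respectively.

A maximizer exists by compactness. Trading budget between two coordinates (`exchange`) shows that it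
is nonincreasing (`antitone`), that active coordinates share one multiplier (`slope_eq`), and that
at most one of them lies in the convex region (`not_both_lt`), necessarily the last. If at least two
are active, then `θ/2 ≤ x_1 < 1`. Hence `θ < 2`, and concavity bounds the multiplier below by its
value at `x_1 = 1`, which is `lamMin`; the maximum of `g'` bounds it above by `lamMax`. The bound
`ellPDS` is exactly the last layer for which these bounds are compatible. This gives the Lambert
form.

Each Lambert form passes the guards by monotonicity of `HMinus` and `HPlus ≤ HMinus`, so the
candidate sets contain every maximizer other than `(1,0,…,0)`. Candidates are feasible, and the zero
placeholder loses to `(1,0,…,0)`, so the best point found is a maximizer. A successful initial test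
says that the search interval is already empty for two layers. Finiteness of the secondary-branch
roots comes from the identity theorem, after changing variable to remove the square-root singularity
at the branch point. -/

/-- `u ↦ u e^{-u}`, the reflection of `w ↦ w e^w`. -/
noncomputable def psi (u : ℝ) : ℝ := u * Real.exp (-u)

/-- The inverse of `psi` on `(0, 1]`. -/
noncomputable def lowerInv (s : ℝ) : ℝ := -lambertW0 (-s)

/-- The inverse of `psi` on `[1, ∞)`. -/
noncomputable def upperInv (s : ℝ) : ℝ := -lambertWm1 (-s)

lemma psi_zero : psi 0 = 0 := by simp [psi]

lemma psi_one : psi 1 = Real.exp (-1) := by simp [psi]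

lemma psi_pos {u : ℝ} (hu : 0 < u) : 0 < psi u := mul_pos hu (Real.exp_pos _)

lemma hasDerivAt_psi (u : ℝ) : HasDerivAt psi ((1 - u) * Real.exp (-u)) u := by
  have h : HasDerivAt (fun u : ℝ => u * Real.exp (-u))
      (1 * Real.exp (-u) + u * (Real.exp (-u) * (-1))) u :=
    (hasDerivAt_id u).mul ((hasDerivAt_id u).neg.exp)
  have e : (1 - u) * Real.exp (-u) = 1 * Real.exp (-u) + u * (Real.exp (-u) * (-1)) := by ring
  rw [e]
  exact h

lemma continuous_psi : Continuous psi := by unfold psi; fun_prop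

lemma analyticAt_psi (u : ℝ) : AnalyticAt ℝ psi u := by
  unfold psi
  fun_prop

lemma strictMonoOn_psi : StrictMonoOn psi (Iic 1) := by
  refine strictMonoOn_of_deriv_pos (convex_Iic 1) continuous_psi.continuousOn fun u hu => ?_
  rw [interior_Iic, mem_Iio] at hu
  rw [(hasDerivAt_psi u).deriv]
  exact mul_pos (by linarith) (Real.exp_pos _)

lemma strictAntiOn_psi : StrictAntiOn psi (Ici 1) := by
  refine strictAntiOn_of_deriv_neg (convex_Ici 1) continuous_psi.continuousOn fun u hu => ?_
  rw [interior_Ici, mem_Ioi] at hu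
  rw [(hasDerivAt_psi u).deriv]
  exact mul_neg_of_neg_of_pos (by linarith) (Real.exp_pos _)

lemma psi_le (u : ℝ) : psi u ≤ Real.exp (-1) := by
  rw [← psi_one]
  rcases le_total u 1 with h | h
  · exact strictMonoOn_psi.monotoneOn h (mem_Iic.2 le_rfl) h
  · exact strictAntiOn_psi.antitoneOn (mem_Ici.2 le_rfl) h h

lemma tendsto_psi_atTop : Tendsto psi atTop (𝓝 0) := by
  have h : Tendsto (fun u : ℝ => u * Real.exp (-u)) atTop (𝓝 0) := by
    simpa using Real.tendsto_pow_mul_exp_neg_atTop_nhds_zero 1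
  exact h

lemma neg_mul_exp_neg (u : ℝ) : -u * Real.exp (-u) = -psi u := by simp [psi]

lemma exists_lower_psi_eq {s : ℝ} (hs : 0 < s) (hs' : s ≤ Real.exp (-1)) :
    ∃ u ∈ Ioc (0 : ℝ) 1, psi u = s := by
  obtain ⟨u, hu, h⟩ := intermediate_value_Icc zero_le_one continuous_psi.continuousOn
    (show s ∈ Icc (psi 0) (psi 1) by rw [psi_zero, psi_one]; exact ⟨hs.le, hs'⟩)
  refine ⟨u, ⟨lt_of_le_of_ne hu.1 ?_, hu.2⟩, h⟩
  rintro rfl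
  rw [psi_zero] at h
  exact hs.ne h

lemma exists_upper_psi_eq {s : ℝ} (hs : 0 < s) (hs' : s ≤ Real.exp (-1)) :
    ∃ u ∈ Ici (1 : ℝ), psi u = s := by
  obtain ⟨b, hb, hb1⟩ := ((tendsto_psi_atTop.eventually (gt_mem_nhds hs)).and
    (eventually_ge_atTop (1 : ℝ))).exists
  obtain ⟨u, hu, h⟩ := intermediate_value_Icc' hb1 continuous_psi.continuousOn
    (show s ∈ Icc (psi b) (psi 1) by rw [psi_one]; exact ⟨hb.le, hs'⟩)
  exact ⟨u, hu.1, h⟩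

lemma lowerInv_spec {s : ℝ} (hs : 0 < s) (hs' : s ≤ Real.exp (-1)) :
    lowerInv s ∈ Ioc (0 : ℝ) 1 ∧ psi (lowerInv s) = s := by
  obtain ⟨u, hu, h⟩ := exists_lower_psi_eq hs hs'
  have hex : ∃ w ∈ Ico (-1 : ℝ) 0, w * Real.exp w = -s :=
    ⟨-u, ⟨by linarith [hu.2], by linarith [hu.1]⟩, by rw [neg_mul_exp_neg, h]⟩
  have h1 := Function.invFunOn_mem hex
  have h2 := Function.invFunOn_eq hex
  change lambertW0 (-s) ∈ _ at h1
  change lambertW0 (-s) * Real.exp (lambertW0 (-s)) = -s at h2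
  refine ⟨⟨by unfold lowerInv; linarith [h1.2], by unfold lowerInv; linarith [h1.1]⟩, ?_⟩
  simp only [psi, lowerInv, neg_neg]
  linarith

lemma upperInv_spec {s : ℝ} (hs : 0 < s) (hs' : s ≤ Real.exp (-1)) :
    1 ≤ upperInv s ∧ psi (upperInv s) = s := by
  obtain ⟨u, hu, h⟩ := exists_upper_psi_eq hs hs'
  rw [mem_Ici] at hu
  have hex : ∃ w ∈ Iic (-1 : ℝ), w * Real.exp w = -s :=
    ⟨-u, by rw [mem_Iic]; linarith, by rw [neg_mul_exp_neg, h]⟩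
  have h1 := Function.invFunOn_mem hex
  have h2 := Function.invFunOn_eq hex
  change lambertWm1 (-s) ∈ _ at h1
  change lambertWm1 (-s) * Real.exp (lambertWm1 (-s)) = -s at h2
  rw [mem_Iic] at h1
  refine ⟨by unfold upperInv; linarith, ?_⟩
  simp only [psi, upperInv, neg_neg]
  linarith

lemma lowerInv_psi {u : ℝ} (hu : 0 < u) (hu' : u ≤ 1) : lowerInv (psi u) = u := by
  have h := lowerInv_spec (psi_pos hu) (psi_le u)
  exact strictMonoOn_psi.injOn h.1.2 hu' h.2

lemma upperInv_psi {u : ℝ} (hu : 1 ≤ u) : upperInv (psi u) = u := by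
  have h := upperInv_spec (psi_pos (by linarith : 0 < u)) (psi_le u)
  exact strictAntiOn_psi.injOn h.1 hu h.2

lemma strictMonoOn_lowerInv : StrictMonoOn lowerInv (Ioc 0 (Real.exp (-1))) := by
  intro s hs t ht hst
  have h1 := lowerInv_spec hs.1 hs.2
  have h2 := lowerInv_spec ht.1 ht.2
  rw [← strictMonoOn_psi.lt_iff_lt h1.1.2 h2.1.2, h1.2, h2.2]
  exact hst

/-- Away from the critical value `e^{-1}`, `psi` has nonzero derivative at the preimage, so
analyticity of `lowerInv` can be tested on `lowerInv ∘ psi`, which is locally the identity. -/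
lemma analyticAt_lowerInv {s : ℝ} (hs : 0 < s) (hs' : s < Real.exp (-1)) :
    AnalyticAt ℝ lowerInv s := by
  obtain ⟨hu, h⟩ := lowerInv_spec hs hs'.le
  have hu1 : lowerInv s < 1 := by
    refine lt_of_le_of_ne hu.2 fun e => ?_
    rw [e, psi_one] at h
    exact hs'.ne' h
  have hd : deriv psi (lowerInv s) ≠ 0 := by
    rw [(hasDerivAt_psi _).deriv]
    exact mul_ne_zero (by linarith) (Real.exp_pos _).ne'
  have key := analyticAt_comp_iff_of_deriv_ne_zero (g := lowerInv) (analyticAt_psi _) hd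
  rw [h] at key
  refine key.1 (analyticAt_id.congr ?_)
  filter_upwards [Ioo_mem_nhds hu.1 hu1] with u hu
  exact (lowerInv_psi hu.1 hu.2.le).symm

lemma continuousOn_lowerInv : ContinuousOn lowerInv (Ioc 0 (Real.exp (-1))) := by
  intro s hs
  rcases lt_or_eq_of_le hs.2 with h | h
  · exact (analyticAt_lowerInv hs.1 h).continuousAt.continuousWithinAt
  · subst h
    refine ContinuousWithinAt.mono ?_ Ioc_subset_Iic_self
    have e1 : lowerInv (Real.exp (-1)) = 1 := by rw [← psi_one, lowerInv_psi one_pos le_rfl]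
    -- At the branch point analyticity fails. A monotone function is left-continuous there once it
    -- takes values arbitrarily close below `1`; the `max` with `1/2` keeps the chosen preimage
    -- positive.
    refine strictMonoOn_lowerInv.continuousWithinAt_left_of_exists_between
      (Ioc_mem_nhdsLE hs.1) fun b hb => ?_
    rw [e1] at hb ⊢
    have h0 : 0 < max b (1 / 2) := by positivity
    have h1 : max b (1 / 2) < 1 := max_lt hb (by norm_num)
    refine ⟨psi (max b (1 / 2)), ⟨psi_pos h0, psi_le _⟩, ?_⟩
    rw [lowerInv_psi h0 h1.le]
    exact ⟨le_max_left _ _, h1⟩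

/-- On `u ≤ 1` one has `u e^{-1} ≤ u e^{-u}`. This linear bound later forces the principal-branch
term to blow up as its argument tends to zero. -/
lemma lowerInv_le {s : ℝ} (hs : 0 < s) (hs' : s ≤ Real.exp (-1)) :
    lowerInv s ≤ Real.exp 1 * s := by
  obtain ⟨hu, h⟩ := lowerInv_spec hs hs'
  have h1 : lowerInv s * Real.exp (-1) ≤ s := by
    conv_rhs => rw [← h]
    exact mul_le_mul_of_nonneg_left (Real.exp_le_exp.2 (by linarith [hu.2])) hu.1.le
  have h2 : Real.exp 1 * Real.exp (-1) = 1 := by rw [← Real.exp_add]; simp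
  calc lowerInv s = Real.exp 1 * (lowerInv s * Real.exp (-1)) := by
        linear_combination (-lowerInv s) * h2
    _ ≤ Real.exp 1 * s := mul_le_mul_of_nonneg_left h1 (Real.exp_pos _).le

/-! ### The reward function -/

/-- The derivative of `g θ` at `x > 0`. -/
noncomputable def slope (θ x : ℝ) : ℝ := 4 / θ * psi (θ / (2 * x)) ^ 2

lemma g_zero (θ : ℝ) : g θ 0 = 0 := by simp [g]

lemma g_of_pos {θ x : ℝ} (hx : 0 < x) : g θ x = Real.exp (-(θ / x)) := by simp [g, hx.ne']

lemma g_pos {θ x : ℝ} (hx : 0 < x) : 0 < g θ x := by rw [g_of_pos hx]; exact Real.exp_pos _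

lemma strictMonoOn_g {θ : ℝ} (hθ : 0 < θ) : StrictMonoOn (g θ) (Ici 0) := by
  intro x hx y hy hxy
  rw [mem_Ici] at hx hy
  rcases hx.eq_or_lt with rfl | hx
  · rw [g_zero]
    exact g_pos hxy
  · rw [g_of_pos hx, g_of_pos (hx.trans hxy), Real.exp_lt_exp, neg_lt_neg_iff]
    exact div_lt_div_of_pos_left hθ hx hxy

lemma hasDerivAt_g {θ x : ℝ} (hθ : 0 < θ) (hx : 0 < x) : HasDerivAt (g θ) (slope θ x) x := by
  have h : HasDerivAt (fun x => Real.exp (-(θ * x⁻¹)))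
      (Real.exp (-(θ * x⁻¹)) * (-(θ * (-(x ^ 2)⁻¹)))) x :=
    (((hasDerivAt_inv hx.ne').const_mul θ).neg).exp
  have e : slope θ x = Real.exp (-(θ * x⁻¹)) * (-(θ * (-(x ^ 2)⁻¹))) := by
    have : Real.exp (-(θ * x⁻¹)) = Real.exp (-(θ / (2 * x))) ^ 2 := by
      rw [← Real.exp_nat_mul]
      congr 1
      field_simp
      norm_num
    rw [this]
    unfold slope psi
    field_simp
    norm_num
  rw [e]
  refine h.congr_of_eventuallyEq ?_
  filter_upwards [lt_mem_nhds hx] with y hy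
  rw [g_of_pos hy, div_eq_mul_inv]

lemma continuousOn_g {θ : ℝ} (hθ : 0 < θ) : ContinuousOn (g θ) (Ici 0) := by
  intro x hx
  rcases (mem_Ici.1 hx).eq_or_lt with rfl | hx
  · rw [← Ioi_insert, continuousWithinAt_insert_self, ContinuousWithinAt, g_zero]
    have h : Tendsto (fun x : ℝ => Real.exp (-(θ * x⁻¹))) (𝓝[>] 0) (𝓝 0) :=
      Real.tendsto_exp_neg_atTop_nhds_zero.comp (tendsto_inv_nhdsGT_zero.const_mul_atTop hθ)
    refine h.congr' ?_
    filter_upwards [self_mem_nhdsWithin] with y hy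
    rw [g_of_pos hy, div_eq_mul_inv]
  · exact (hasDerivAt_g hθ hx).continuousAt.continuousWithinAt

/-- The argument `θ/(2x)` exceeds `1` exactly for `x < θ/2`, where `psi` is decreasing; composing
two decreasing maps makes the slope increase. Beyond `θ/2` the monotonicity reverses. -/
lemma slope_strictMonoOn {θ : ℝ} (hθ : 0 < θ) : StrictMonoOn (slope θ) (Ioo 0 (θ / 2)) := by
  intro x hx y hy hxy
  have h1 : 1 ≤ θ / (2 * y) := by rw [one_le_div (by linarith [hy.1])]; linarith [hy.2]
  have h2 : θ / (2 * y) < θ / (2 * x) :=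
    div_lt_div_of_pos_left hθ (by linarith [hx.1]) (by linarith)
  have h3 := strictAntiOn_psi (mem_Ici.2 h1) (mem_Ici.2 (h1.trans h2.le)) h2
  have h4 := psi_pos (show 0 < θ / (2 * x) by linarith)
  unfold slope
  have : psi (θ / (2 * x)) ^ 2 < psi (θ / (2 * y)) ^ 2 := by gcongr
  gcongr

lemma slope_antitoneOn {θ : ℝ} (hθ : 0 < θ) : AntitoneOn (slope θ) (Ici (θ / 2)) := by
  intro x hx y hy hxy
  rw [mem_Ici] at hx hy
  have h1 : θ / (2 * x) ≤ 1 := by rw [div_le_one (by linarith)]; linarith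
  have h2 : θ / (2 * y) ≤ θ / (2 * x) :=
    div_le_div_of_nonneg_left hθ.le (by linarith) (by linarith)
  have h3 := strictMonoOn_psi.monotoneOn (mem_Iic.2 (h2.trans h1)) (mem_Iic.2 h1) h2
  have h4 := psi_pos (show 0 < θ / (2 * y) from div_pos hθ (by linarith))
  unfold slope
  have : psi (θ / (2 * y)) ^ 2 ≤ psi (θ / (2 * x)) ^ 2 := by gcongr
  gcongr

lemma strictConvexOn_g {θ : ℝ} (hθ : 0 < θ) : StrictConvexOn ℝ (Ioo 0 (θ / 2)) (g θ) := by
  refine StrictMonoOn.strictConvexOn_of_deriv (convex_Ioo _ _)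
    (fun x hx => (hasDerivAt_g hθ hx.1).continuousAt.continuousWithinAt) ?_
  rw [interior_Ioo]
  intro x hx y hy hxy
  rw [(hasDerivAt_g hθ hx.1).deriv, (hasDerivAt_g hθ hy.1).deriv]
  exact slope_strictMonoOn hθ hx hy hxy

lemma slope_le {θ x : ℝ} (hθ : 0 < θ) (hx : 0 < x) : slope θ x ≤ 4 * Real.exp (-2) / θ := by
  have h := psi_pos (show 0 < θ / (2 * x) by positivity)
  have h2 : psi (θ / (2 * x)) ^ 2 ≤ Real.exp (-1) ^ 2 := by gcongr; exact psi_le _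
  have h3 : Real.exp (-1) ^ 2 = Real.exp (-2) := by rw [← Real.exp_nat_mul]; norm_num
  rw [h3] at h2
  unfold slope
  rw [div_mul_eq_mul_div]
  gcongr

lemma slope_one {θ : ℝ} (hθ : 0 < θ) : slope θ 1 = θ * Real.exp (-θ) := by
  have : Real.exp (-θ) = Real.exp (-(θ / (2 * 1))) ^ 2 := by
    rw [← Real.exp_nat_mul]
    congr 1
    norm_num
    ring
  rw [this]
  unfold slope psi
  field_simp
  norm_num

/-! ### First-order and exchange conditions at a maximizer -/

/-- The weight `2^{R i}` of a coordinate. -/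
noncomputable def weight {K : ℕ} (R : ℝ) (i : Fin K) : ℝ := (2 : ℝ) ^ (R * (i : ℝ))

lemma weight_pos {K : ℕ} (R : ℝ) (i : Fin K) : 0 < weight R i :=
  Real.rpow_pos_of_pos two_pos _

lemma weight_zero {K : ℕ} [NeZero K] (R : ℝ) : weight R (0 : Fin K) = 1 := by simp [weight]

lemma strictMono_weight {K : ℕ} {R : ℝ} (hR : 0 < R) :
    StrictMono (weight R : Fin K → ℝ) := by
  intro i j hij
  refine Real.rpow_lt_rpow_of_exponent_lt one_lt_two (mul_lt_mul_of_pos_left ?_ hR)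
  exact_mod_cast hij

lemma mem_feasible {K : ℕ} {R : ℝ} {x : Fin K → ℝ} :
    x ∈ feasible K R ↔ ∑ i, weight R i * x i = 1 ∧ ∀ i, 0 ≤ x i := Iff.rfl

lemma sum_apply_update {ι : Type*} [Fintype ι] [DecidableEq ι] (φ : ι → ℝ → ℝ) (x : ι → ℝ)
    (i : ι) (a : ℝ) :
    ∑ k, φ k (Function.update x i a k) = ∑ k, φ k (x k) + (φ i a - φ i (x i)) := by
  rw [← Finset.add_sum_erase Finset.univ _ (Finset.mem_univ i),
    ← Finset.add_sum_erase Finset.univ (fun k => φ k (x k)) (Finset.mem_univ i),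
    Function.update_self, Finset.sum_congr rfl fun k hk => by
      rw [Function.update_of_ne (Finset.ne_of_mem_erase hk)]]
  ring

lemma firstVec_mem_feasible (K : ℕ) [NeZero K] (R : ℝ) : firstVec K ∈ feasible K R := by
  refine mem_feasible.2 ⟨?_, fun i => ?_⟩
  · simp [firstVec, Pi.single_apply, weight_zero]
  · unfold firstVec
    by_cases h : i = 0
    · subst h; simp
    · simp [h]

lemma G_firstVec (K : ℕ) [NeZero K] (θ : ℝ) (d : Fin K → ℝ) :
    G θ d (firstVec K) = Real.exp (-θ) * d 0 := by
  unfold G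
  rw [Finset.sum_eq_single 0]
  · simp [firstVec, g]
  · intro i _ hi
    simp [firstVec, g, hi]
  · simp

lemma exists_isGlobalMaximizer {K : ℕ} [NeZero K] (R : ℝ) {θ : ℝ} (hθ : 0 < θ)
    (d : Fin K → ℝ) : ∃ x, IsGlobalMaximizer R θ d x := by
  have hcl : IsClosed (feasible K R) := by
    have : feasible K R = {x | ∑ i, weight R i * x i = 1} ∩ ⋂ i, {x | 0 ≤ x i} := by
      ext x
      simp [mem_feasible]
    rw [this]
    refine (isClosed_eq (by fun_prop) continuous_const).inter (isClosed_iInter fun i => ?_)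
    exact isClosed_le continuous_const (continuous_apply i)
  have hcpt : IsCompact (feasible K R) := by
    refine IsCompact.of_isClosed_subset
      (isCompact_univ_pi fun i => isCompact_Icc (a := (0 : ℝ)) (b := 1 / weight R i)) hcl ?_
    intro x hx i _
    obtain ⟨h1, h2⟩ := mem_feasible.1 hx
    refine ⟨h2 i, ?_⟩
    rw [le_div_iff₀ (weight_pos R i), ← h1, mul_comm]
    exact Finset.single_le_sum (f := fun i => weight R i * x i)
      (fun k _ => mul_nonneg (weight_pos R k).le (h2 k)) (Finset.mem_univ i)
  have hcont : ContinuousOn (G θ d) (feasible K R) := by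
    unfold G
    refine continuousOn_finsetSum _ fun i _ => ContinuousOn.mul ?_ continuousOn_const
    exact (continuousOn_g hθ).comp (continuous_apply i).continuousOn fun x hx => hx.2 i
  obtain ⟨x, hx, hmax⟩ := hcpt.exists_isMaxOn ⟨_, firstVec_mem_feasible K R⟩ hcont
  exact ⟨x, hx, fun y hy => hmax hy⟩

namespace IsGlobalMaximizer

variable {K : ℕ} {R θ : ℝ} {d x : Fin K → ℝ}

/-- The new pair may cost less than the old one: the unspent budget goes to coordinate `i`, and
since `g` is monotone this only helps. -/
lemma exchange (hx : IsGlobalMaximizer R θ d x) (hθ : 0 < θ) (hdpos : ∀ i, 0 < d i)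
    {i j : Fin K} (hij : i ≠ j) {a b : ℝ} (ha : 0 ≤ a) (hb : 0 ≤ b)
    (hab : weight R i * a + weight R j * b ≤ weight R i * x i + weight R j * x j) :
    g θ a * d i + g θ b * d j ≤ g θ (x i) * d i + g θ (x j) * d j := by
  obtain ⟨hs, hn⟩ := mem_feasible.1 hx.1
  obtain ⟨a', haa', ha'⟩ : ∃ a' ≥ a,
      weight R i * a' + weight R j * b = weight R i * x i + weight R j * x j := by
    refine ⟨(weight R i * x i + weight R j * x j - weight R j * b) / weight R i, ?_, ?_⟩
    · rw [ge_iff_le, le_div_iff₀ (weight_pos R i)]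
      linarith
    · rw [mul_div_cancel₀ _ (weight_pos R i).ne']
      ring
  have hji : Function.update x i a' j = x j := Function.update_of_ne hij.symm _ _
  have hy : Function.update (Function.update x i a') j b ∈ feasible K R := by
    refine mem_feasible.2 ⟨?_, fun k => ?_⟩
    · rw [sum_apply_update (fun k t => weight R k * t), sum_apply_update (fun k t => weight R k * t),
        hs, hji]
      linarith
    · rcases eq_or_ne k j with rfl | hkj
      · simpa using hb
      rcases eq_or_ne k i with rfl | hki
      · simpa [hkj] using ha.trans haa'
      · simpa [hkj, hki] using hn k
  have h := hx.2 _ hy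
  unfold G at h
  rw [sum_apply_update (fun k t => g θ t * d k), sum_apply_update (fun k t => g θ t * d k), hji] at h
  have h2 := mul_le_mul_of_nonneg_right
    ((strictMonoOn_g hθ).monotoneOn (mem_Ici.2 ha) (mem_Ici.2 (ha.trans haa')) haa') (hdpos i).le
  linarith

lemma antitone (hx : IsGlobalMaximizer R θ d x) (hR : 0 < R) (hθ : 0 < θ) (hd : StrictAnti d)
    (hdpos : ∀ i, 0 < d i) : Antitone x := by
  intro i j hij
  rcases hij.eq_or_lt with rfl | hij
  · exact le_rfl
  by_contra! hlt
  have hn := hx.1.2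
  -- This is the budget saved by swapping the two values; the swap also gains reward because `d i >
  -- d j`.
  have hw : 0 < (weight R j - weight R i) * (x j - x i) :=
    mul_pos (sub_pos.2 (strictMono_weight hR hij)) (sub_pos.2 hlt)
  have h := hx.exchange hθ hdpos hij.ne (hn j) (hn i) (by linarith)
  have hg : 0 < (d i - d j) * (g θ (x j) - g θ (x i)) :=
    mul_pos (sub_pos.2 (hd hij)) (sub_pos.2 (strictMonoOn_g hθ (hn i) (hn j) hlt))
  linarith

/-- Moving an amount `t` of budget from `j` to `i` has a local maximum at `t = 0`, so its derivative
vanishes there. -/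
lemma slope_eq (hx : IsGlobalMaximizer R θ d x) (hθ : 0 < θ) (hdpos : ∀ i, 0 < d i)
    {i j : Fin K} (hij : i ≠ j) (hi : 0 < x i) (hj : 0 < x j) :
    slope θ (x i) * d i / weight R i = slope θ (x j) * d j / weight R j := by
  have hi' : HasDerivAt (fun t : ℝ => x i + t / weight R i) (1 / weight R i) 0 :=
    ((hasDerivAt_id 0).div_const _).const_add _
  have hj' : HasDerivAt (fun t : ℝ => x j - t / weight R j) (-(1 / weight R j)) 0 :=
    ((hasDerivAt_id 0).div_const _).const_sub _
  have hgi : HasDerivAt (g θ) (slope θ (x i)) (x i + 0 / weight R i) := by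
    simpa using hasDerivAt_g hθ hi
  have hgj : HasDerivAt (g θ) (slope θ (x j)) (x j - 0 / weight R j) := by
    simpa using hasDerivAt_g hθ hj
  have hder := ((hgi.comp 0 hi').mul_const (d i)).add ((hgj.comp 0 hj').mul_const (d j))
  have hmax : IsLocalMax (fun t : ℝ => g θ (x i + t / weight R i) * d i +
      g θ (x j - t / weight R j) * d j) 0 := by
    have e1 : ∀ᶠ t : ℝ in 𝓝 0, 0 < x i + t / weight R i :=
      hi'.continuousAt.eventually (lt_mem_nhds (by simpa using hi))
    have e2 : ∀ᶠ t : ℝ in 𝓝 0, 0 < x j - t / weight R j :=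
      hj'.continuousAt.eventually (lt_mem_nhds (by simpa using hj))
    filter_upwards [e1, e2] with t h1 h2
    simp only [zero_div, add_zero, sub_zero]
    refine hx.exchange hθ hdpos hij h1.le h2.le (le_of_eq ?_)
    have := (weight_pos R i).ne'
    have := (weight_pos R j).ne'
    field_simp
    ring
  have h := hmax.hasDerivAt_eq_zero hder
  linear_combination h

/-- Transfer a small budget from one coordinate to the other, and then in the reverse direction. By
strict convexity the two outcomes average strictly above the original value, so one of them improves
it. -/
lemma not_both_lt (hx : IsGlobalMaximizer R θ d x) (hθ : 0 < θ) (hdpos : ∀ i, 0 < d i)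
    {i j : Fin K} (hij : i ≠ j) (hi : x i ∈ Ioo 0 (θ / 2)) (hj : x j ∈ Ioo 0 (θ / 2)) :
    False := by
  have key : ∀ k, x k ∈ Ioo 0 (θ / 2) → ∀ᶠ t : ℝ in 𝓝[>] 0,
      (x k + t / weight R k ∈ Ioo 0 (θ / 2) ∧ x k - t / weight R k ∈ Ioo 0 (θ / 2)) ∧
      2 * (g θ (x k) * d k) <
        g θ (x k + t / weight R k) * d k + g θ (x k - t / weight R k) * d k := by
    intro k hk
    have c1 : ContinuousAt (fun t : ℝ => x k + t / weight R k) 0 := by fun_prop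
    have c2 : ContinuousAt (fun t : ℝ => x k - t / weight R k) 0 := by fun_prop
    have e1 := c1.eventually (Ioo_mem_nhds (by simpa using hk.1) (by simpa using hk.2))
    have e2 := c2.eventually (Ioo_mem_nhds (by simpa using hk.1) (by simpa using hk.2))
    filter_upwards [nhdsWithin_le_nhds e1, nhdsWithin_le_nhds e2, self_mem_nhdsWithin]
      with t h1 h2 ht
    have hpos : 0 < t / weight R k := div_pos ht (weight_pos R k)
    have h := (strictConvexOn_g hθ).2 h1 h2 (by linarith)
      (show (0 : ℝ) < 1 / 2 by norm_num) (show (0 : ℝ) < 1 / 2 by norm_num) (by norm_num)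
    simp only [smul_eq_mul] at h
    rw [show 1 / 2 * (x k + t / weight R k) + 1 / 2 * (x k - t / weight R k) = x k by ring] at h
    refine ⟨⟨h1, h2⟩, ?_⟩
    have := mul_lt_mul_of_pos_right h (hdpos k)
    linarith
  obtain ⟨t, ⟨⟨i1, i2⟩, i3⟩, ⟨j1, j2⟩, j3⟩ := ((key i hi).and (key j hj)).exists
  have hwi := (weight_pos R i).ne'
  have hwj := (weight_pos R j).ne'
  have A := hx.exchange hθ hdpos hij i1.1.le j2.1.le (le_of_eq (by field_simp; ring))
  have B := hx.exchange hθ hdpos hij i2.1.le j1.1.le (le_of_eq (by field_simp; ring))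
  linarith

end IsGlobalMaximizer

/-! ### The branches as solutions of the first-order condition -/

section branches

variable {K : ℕ} {R θ : ℝ} {d : Fin K → ℝ}

lemma c_eq (R θ : ℝ) (d : Fin K → ℝ) (i : Fin K) (lam : ℝ) :
    c R θ d i lam = lam * θ * weight R i / d i := rfl

lemma xMinus_eq (R θ : ℝ) (d : Fin K → ℝ) (i : Fin K) (lam : ℝ) :
    xMinus R θ d i lam = θ / (2 * lowerInv (√(c R θ d i lam) / 2)) := by
  simp only [xMinus, lowerInv]
  ring_nf

lemma xPlus_eq (R θ : ℝ) (d : Fin K → ℝ) (i : Fin K) (lam : ℝ) :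
    xPlus R θ d i lam = θ / (2 * upperInv (√(c R θ d i lam) / 2)) := by
  simp only [xPlus, upperInv]
  ring_nf

lemma half_sqrt_four_mul_psi_sq {u : ℝ} (hu : 0 < u) : √(4 * psi u ^ 2) / 2 = psi u := by
  rw [show 4 * psi u ^ 2 = (2 * psi u) ^ 2 by ring, Real.sqrt_sq (by linarith [psi_pos hu])]
  ring

lemma half_sqrt_c_of_slope (hθ : 0 < θ) (hdpos : ∀ i, 0 < d i) {i : Fin K} {lam t : ℝ}
    (ht : 0 < t) (h : slope θ t * d i / weight R i = lam) :
    √(c R θ d i lam) / 2 = psi (θ / (2 * t)) := by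
  have hw := (weight_pos R i).ne'
  have hdi := (hdpos i).ne'
  rw [← half_sqrt_four_mul_psi_sq (show 0 < θ / (2 * t) by positivity), c_eq, ← h]
  congr 2
  unfold slope
  field_simp

lemma xMinus_of_slope (hθ : 0 < θ) (hdpos : ∀ i, 0 < d i) {i : Fin K} {lam t : ℝ}
    (ht : θ / 2 ≤ t) (h : slope θ t * d i / weight R i = lam) : xMinus R θ d i lam = t := by
  have ht0 : 0 < t := by linarith
  rw [xMinus_eq, half_sqrt_c_of_slope hθ hdpos ht0 h, lowerInv_psi (by positivity)]
  · field_simp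
  · rw [div_le_one (by linarith)]
    linarith

lemma xPlus_of_slope (hθ : 0 < θ) (hdpos : ∀ i, 0 < d i) {i : Fin K} {lam t : ℝ}
    (ht0 : 0 < t) (ht : t ≤ θ / 2) (h : slope θ t * d i / weight R i = lam) :
    xPlus R θ d i lam = t := by
  rw [xPlus_eq, half_sqrt_c_of_slope hθ hdpos ht0 h, upperInv_psi]
  · field_simp
  · rw [one_le_div (by linarith)]
    linarith

/-- The multiplier `lamMax` of layer `l` is the one with `c_l = 4 e^{-2}`, the branch point. Earlier
layers have smaller weight and larger `d`, so their arguments are no larger. -/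
lemma half_sqrt_c_mem (hR : 0 < R) (hθ : 0 < θ) (hd : StrictAnti d) (hdpos : ∀ i, 0 < d i)
    {i l : Fin K} (hil : i ≤ l) {lam : ℝ} (h0 : 0 < lam) (hlam : lam ≤ lamMax R θ d l) :
    √(c R θ d i lam) / 2 ∈ Ioc 0 (Real.exp (-1)) := by
  have hw := weight_pos R i
  have hwl := weight_pos R l
  have hdi := hdpos i
  have hdl := hdpos l
  have hww : weight R i ≤ weight R l := (strictMono_weight hR).monotone hil
  have hdd : d l ≤ d i := hd.antitone hil
  refine ⟨?_, ?_⟩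
  · rw [c_eq]
    positivity
  · have h1 : lam * (θ * weight R l) ≤ 4 * Real.exp (-2) * d l := by
      rw [← le_div_iff₀ (by positivity)]
      exact hlam
    have h2 : c R θ d i lam ≤ (2 * Real.exp (-1)) ^ 2 := by
      rw [mul_pow, ← Real.exp_nat_mul, c_eq, div_le_iff₀ hdi]
      calc lam * θ * weight R i ≤ lam * θ * weight R l := by gcongr
        _ = lam * (θ * weight R l) := by ring
        _ ≤ 4 * Real.exp (-2) * d l := h1
        _ ≤ 4 * Real.exp (-2) * d i := by gcongr
        _ = _ := by norm_num
    have h3 := Real.sqrt_le_sqrt h2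
    rw [Real.sqrt_sq (by positivity)] at h3
    linarith

lemma half_sqrt_c_lt (hθ : 0 < θ) (hdpos : ∀ i, 0 < d i) (i : Fin K) {a b : ℝ}
    (ha : 0 < a) (hab : a < b) : √(c R θ d i a) / 2 < √(c R θ d i b) / 2 := by
  have hw := weight_pos R i
  have hdi := hdpos i
  have : c R θ d i a < c R θ d i b := by
    rw [c_eq, c_eq]
    gcongr
  have h0 : 0 ≤ c R θ d i a := by
    rw [c_eq]
    positivity
  gcongr

lemma half_le_xMinus (hR : 0 < R) (hθ : 0 < θ) (hd : StrictAnti d) (hdpos : ∀ i, 0 < d i)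
    {i l : Fin K} (hil : i ≤ l) {lam : ℝ} (h0 : 0 < lam) (hlam : lam ≤ lamMax R θ d l) :
    θ / 2 ≤ xMinus R θ d i lam := by
  have h := half_sqrt_c_mem hR hθ hd hdpos hil h0 hlam
  have hL := (lowerInv_spec h.1 h.2).1
  rw [xMinus_eq, le_div_iff₀ (by linarith [hL.1])]
  nlinarith [hL.1, hL.2]

lemma xPlus_mem (hR : 0 < R) (hθ : 0 < θ) (hd : StrictAnti d) (hdpos : ∀ i, 0 < d i)
    {i l : Fin K} (hil : i ≤ l) {lam : ℝ} (h0 : 0 < lam) (hlam : lam ≤ lamMax R θ d l) :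
    xPlus R θ d i lam ∈ Ioc 0 (θ / 2) := by
  have h := half_sqrt_c_mem hR hθ hd hdpos hil h0 hlam
  have hL := (upperInv_spec h.1 h.2).1
  rw [xPlus_eq]
  refine ⟨div_pos hθ (by linarith), ?_⟩
  rw [div_le_iff₀ (by linarith)]
  nlinarith

lemma strictAntiOn_xMinus (hR : 0 < R) (hθ : 0 < θ) (hd : StrictAnti d) (hdpos : ∀ i, 0 < d i)
    {i l : Fin K} (hil : i ≤ l) : StrictAntiOn (xMinus R θ d i) (Ioc 0 (lamMax R θ d l)) := by
  intro a ha b hb hab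
  have h1 := half_sqrt_c_mem hR hθ hd hdpos hil ha.1 ha.2
  have h2 := half_sqrt_c_mem hR hθ hd hdpos hil hb.1 hb.2
  have h3 := strictMonoOn_lowerInv h1 h2 (half_sqrt_c_lt hθ hdpos i ha.1 hab)
  have h4 := (lowerInv_spec h1.1 h1.2).1.1
  rw [xMinus_eq, xMinus_eq]
  exact div_lt_div_of_pos_left hθ (by linarith) (by linarith)

lemma continuousOn_xMinus (hR : 0 < R) (hθ : 0 < θ) (hd : StrictAnti d) (hdpos : ∀ i, 0 < d i)
    {i l : Fin K} (hil : i ≤ l) : ContinuousOn (xMinus R θ d i) (Ioc 0 (lamMax R θ d l)) := by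
  have e : xMinus R θ d i = fun lam => θ / (2 * lowerInv (√(c R θ d i lam) / 2)) :=
    funext fun lam => xMinus_eq R θ d i lam
  rw [e]
  have hc : Continuous fun lam => √(c R θ d i lam) / 2 := by
    unfold c
    fun_prop
  refine continuousOn_const.div (continuousOn_const.mul (continuousOn_lowerInv.comp
    hc.continuousOn fun a ha => half_sqrt_c_mem hR hθ hd hdpos hil ha.1 ha.2)) fun a ha => ?_
  have h1 := half_sqrt_c_mem hR hθ hd hdpos hil ha.1 ha.2
  have := (lowerInv_spec h1.1 h1.2).1.1
  positivity

lemma strictAntiOn_HMinus (hR : 0 < R) (hθ : 0 < θ) (hd : StrictAnti d) (hdpos : ∀ i, 0 < d i)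
    (l : Fin K) : StrictAntiOn (HMinus R θ d l) (Ioc 0 (lamMax R θ d l)) := by
  intro a ha b hb hab
  refine Finset.sum_lt_sum_of_nonempty ⟨l, Finset.mem_Iic.2 le_rfl⟩ fun i hi => ?_
  exact mul_lt_mul_of_pos_left
    (strictAntiOn_xMinus hR hθ hd hdpos (Finset.mem_Iic.1 hi) ha hb hab) (weight_pos R i)

lemma continuousOn_HMinus (hR : 0 < R) (hθ : 0 < θ) (hd : StrictAnti d) (hdpos : ∀ i, 0 < d i)
    (l : Fin K) : ContinuousOn (HMinus R θ d l) (Ioc 0 (lamMax R θ d l)) := by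
  unfold HMinus
  exact continuousOn_finsetSum _ fun i hi => continuousOn_const.mul
    (continuousOn_xMinus hR hθ hd hdpos (Finset.mem_Iic.1 hi))

lemma Iic_sum_eq (f : Fin K → ℝ) (l : Fin K) :
    ∑ i ∈ Finset.Iic l, f i = f l + ∑ i ∈ Finset.Iio l, f i := by
  rw [← Finset.Iio_insert, Finset.sum_insert (by simp)]

lemma HPlus_le_HMinus (hR : 0 < R) (hθ : 0 < θ) (hd : StrictAnti d) (hdpos : ∀ i, 0 < d i)
    (l : Fin K) {lam : ℝ} (h0 : 0 < lam) (hlam : lam ≤ lamMax R θ d l) :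
    HPlus R θ d l lam ≤ HMinus R θ d l lam := by
  unfold HPlus HMinus
  rw [Iic_sum_eq]
  have h1 := half_le_xMinus hR hθ hd hdpos le_rfl h0 hlam
  have h2 := (xPlus_mem hR hθ hd hdpos le_rfl h0 hlam).2
  gcongr
  exact h2.trans h1

lemma antitone_lamMax (hR : 0 < R) (hθ : 0 < θ) (hd : StrictAnti d) (hdpos : ∀ i, 0 < d i) :
    Antitone (lamMax R θ d) := by
  intro i j hij
  have hw := weight_pos R i
  have hww : weight R i ≤ weight R j := (strictMono_weight hR).monotone hij
  have hdd := hd.antitone hij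
  have hdi := hdpos i
  change 4 * Real.exp (-2) * d j / (θ * weight R j) ≤ 4 * Real.exp (-2) * d i / (θ * weight R i)
  gcongr

lemma lamMin_pos [NeZero K] (hθ : 0 < θ) (hdpos : ∀ i, 0 < d i) : 0 < lamMin θ d := by
  have := hdpos 0
  unfold lamMin
  positivity

lemma existsUnique_rootsMinus [NeZero K] (hR : 0 < R) (hθ : 0 < θ) (hd : StrictAnti d)
    (hdpos : ∀ i, 0 < d i) {l : Fin K} (hle : lamMin θ d ≤ lamMax R θ d l)
    (hguard : guardMinus R θ d l) : ∃! lam, lam ∈ rootsMinus R θ d l := by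
  have hpos : 0 < lamMin θ d := lamMin_pos hθ hdpos
  have hsub : Icc (lamMin θ d) (lamMax R θ d l) ⊆ Ioc 0 (lamMax R θ d l) :=
    fun a ha => ⟨hpos.trans_le ha.1, ha.2⟩
  obtain ⟨lam, hlam, h⟩ := intermediate_value_Icc' hle
    ((continuousOn_HMinus hR hθ hd hdpos l).mono hsub) ⟨hguard.2, hguard.1⟩
  refine ⟨lam, ⟨hlam, h⟩, fun b hb => ?_⟩
  exact (strictAntiOn_HMinus hR hθ hd hdpos l).injOn (hsub hb.1) (hsub hlam) (hb.2.trans h.symm)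

end branches

/-! ### Finiteness of the roots on the secondary branch -/

/-- Infinitely many zeros, all confined to a compact interval, would accumulate at a point of the
domain, and the identity theorem would make `F` vanish everywhere on `Ioi a`. -/
lemma finite_zeros_of_analyticOnNhd {F : ℝ → ℝ} {a b : ℝ} (hab : a < b)
    (hF : AnalyticOnNhd ℝ F (Ioi a)) (hne : ∀ᶠ u in atTop, F u ≠ 0) :
    {u ∈ Ici b | F u = 0}.Finite := by
  obtain ⟨B, hB⟩ := eventually_atTop.1 hne
  by_contra hinf
  have hsub : {u ∈ Ici b | F u = 0} ⊆ Icc b B := fun u hu =>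
    ⟨hu.1, le_of_not_ge fun h => hB u h hu.2⟩
  obtain ⟨p, hp, hacc⟩ := Set.Infinite.exists_accPt_of_subset_isCompact hinf isCompact_Icc hsub
  have hfreq : ∃ᶠ z in 𝓝[≠] p, F z = 0 :=
    (accPt_iff_frequently_nhdsNE.1 hacc).mono fun z hz => hz.2
  have h := hF.eqOn_zero_of_preconnected_of_frequently_eq_zero isPreconnected_Ioi
    (mem_Ioi.2 (hab.trans_le hp.1)) hfreq
  exact hB (max B b) (le_max_left _ _) (h (mem_Ioi.2 (hab.trans_le (le_max_right _ _))))

section roots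

variable {K : ℕ} {R θ : ℝ} {d : Fin K → ℝ}

/-- The ratio `√(c_i / c_l)`, which does not depend on the multiplier. -/
noncomputable def ratio (R : ℝ) (d : Fin K → ℝ) (l i : Fin K) : ℝ :=
  √(weight R i * d l / (d i * weight R l))

lemma ratio_pos (hdpos : ∀ i, 0 < d i) (l i : Fin K) : 0 < ratio R d l i := by
  have h1 := weight_pos R i
  have h2 := weight_pos R l
  have h3 := hdpos i
  have h4 := hdpos l
  unfold ratio
  positivity

lemma ratio_lt_one (hR : 0 < R) (hd : StrictAnti d) (hdpos : ∀ i, 0 < d i) {l i : Fin K}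
    (hil : i < l) : ratio R d l i < 1 := by
  have h1 := weight_pos R i
  have h2 := weight_pos R l
  have h3 := hdpos i
  have h4 := hdpos l
  have h5 := strictMono_weight hR hil
  have h6 := hd hil
  unfold ratio
  rw [Real.sqrt_lt' one_pos, one_pow, div_lt_one (by positivity), mul_comm (d i)]
  gcongr

lemma half_sqrt_c_eq_ratio_mul (hdpos : ∀ i, 0 < d i) (l i : Fin K) (lam : ℝ) :
    √(c R θ d i lam) / 2 = ratio R d l i * (√(c R θ d l lam) / 2) := by
  have h1 := weight_pos R i
  have h2 := weight_pos R l
  have h3 := hdpos i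
  have h4 := hdpos l
  unfold ratio
  rw [← mul_div_assoc, ← Real.sqrt_mul (by positivity), c_eq, c_eq]
  congr 2
  field_simp

/-- `H_l^+ - 1` as a function of the inverse-branch variable `u = θ / (2 x_l)`. -/
noncomputable def HPlusAux (R θ : ℝ) (d : Fin K → ℝ) (l : Fin K) (u : ℝ) : ℝ :=
  weight R l * (θ / (2 * u)) +
    ∑ i ∈ Finset.Iio l, weight R i * (θ / (2 * lowerInv (ratio R d l i * psi u))) - 1

lemma ratio_mul_psi_mem (hR : 0 < R) (hd : StrictAnti d) (hdpos : ∀ i, 0 < d i) {l i : Fin K}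
    (hil : i < l) {u : ℝ} (hu : 0 < u) :
    ratio R d l i * psi u ∈ Ioo 0 (Real.exp (-1)) := by
  have h1 := psi_pos hu
  have h2 := ratio_pos (R := R) hdpos l i
  refine ⟨by positivity, ?_⟩
  calc ratio R d l i * psi u < 1 * psi u :=
        mul_lt_mul_of_pos_right (ratio_lt_one hR hd hdpos hil) h1
    _ ≤ Real.exp (-1) := by rw [one_mul]; exact psi_le u

/-- Since the ratios are below `1`, the arguments of `lowerInv` stay strictly below `e^{-1}` even at
`u = 1`. Thus the variable `u` crosses the branch point of layer `l` without a singularity. -/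
lemma analyticOnNhd_HPlusAux (hR : 0 < R) (hd : StrictAnti d) (hdpos : ∀ i, 0 < d i)
    (l : Fin K) : AnalyticOnNhd ℝ (HPlusAux R θ d l) (Ioi 0) := by
  intro u hu
  rw [mem_Ioi] at hu
  have h1 : AnalyticAt ℝ (fun u : ℝ => weight R l * (θ / (2 * u))) u :=
    analyticAt_const.mul (analyticAt_const.div (analyticAt_const.mul analyticAt_id)
      (mul_ne_zero two_ne_zero hu.ne'))
  have h2 : AnalyticAt ℝ (fun u : ℝ => ∑ i ∈ Finset.Iio l,
      weight R i * (θ / (2 * lowerInv (ratio R d l i * psi u)))) u := by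
    refine Finset.analyticAt_fun_sum _ fun i hi => ?_
    have hm := ratio_mul_psi_mem hR hd hdpos (Finset.mem_Iio.1 hi) hu
    have hL := (lowerInv_spec hm.1 hm.2.le).1.1
    refine analyticAt_const.mul (analyticAt_const.div (analyticAt_const.mul ?_)
      (mul_ne_zero two_ne_zero hL.ne'))
    exact (analyticAt_lowerInv hm.1 hm.2).fun_comp_of_eq
      (f := fun u => ratio R d l i * psi u) (analyticAt_const.fun_mul (analyticAt_psi u)) rfl
  exact (h1.add h2).sub analyticAt_const

/-- As `u → ∞`, the first layer's argument tends to `0`, so its term alone exceeds `1`. Having `0 <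
l` ensures that this layer is in the sum. -/
lemma eventually_HPlusAux_pos [NeZero K] (hR : 0 < R) (hθ : 0 < θ) (hd : StrictAnti d)
    (hdpos : ∀ i, 0 < d i) {l : Fin K} (hl : 0 < l) :
    ∀ᶠ u in atTop, 0 < HPlusAux R θ d l u := by
  have hlim : Tendsto (fun u => 2 * (Real.exp 1 * (ratio R d l 0 * psi u))) atTop (𝓝 0) := by
    simpa using ((tendsto_psi_atTop.const_mul (ratio R d l 0)).const_mul (Real.exp 1)).const_mul 2
  filter_upwards [hlim.eventually (gt_mem_nhds hθ), eventually_gt_atTop 0] with u h1 hu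
  have hnn : ∀ i ∈ Finset.Iio l,
      0 ≤ weight R i * (θ / (2 * lowerInv (ratio R d l i * psi u))) := by
    intro i hi
    have hm := ratio_mul_psi_mem hR hd hdpos (Finset.mem_Iio.1 hi) hu
    have hL := (lowerInv_spec hm.1 hm.2.le).1.1
    have hw := weight_pos R i
    positivity
  have hm := ratio_mul_psi_mem hR hd hdpos hl hu
  have hL := (lowerInv_spec hm.1 hm.2.le).1.1
  have hle := lowerInv_le hm.1 hm.2.le
  have h0 : 1 < weight R (0 : Fin K) * (θ / (2 * lowerInv (ratio R d l 0 * psi u))) := by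
    rw [weight_zero, one_mul, one_lt_div (by positivity)]
    linarith
  have hsum := Finset.single_le_sum hnn (Finset.mem_Iio.2 hl)
  have hlast : 0 < weight R l * (θ / (2 * u)) := by
    have hw := weight_pos R l
    positivity
  unfold HPlusAux
  linarith

lemma finite_rootsPlus [NeZero K] (hR : 0 < R) (hθ : 0 < θ) (hd : StrictAnti d)
    (hdpos : ∀ i, 0 < d i) {l : Fin K} (hl : 0 < l) : (rootsPlus R θ d l).Finite := by
  have hpos : 0 < lamMin θ d := lamMin_pos hθ hdpos
  have hfin := finite_zeros_of_analyticOnNhd one_pos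
    (analyticOnNhd_HPlusAux (θ := θ) hR hd hdpos l)
    ((eventually_HPlusAux_pos hR hθ hd hdpos hl).mono fun _ h => h.ne')
  have hspec : ∀ lam ∈ rootsPlus R θ d l, 1 ≤ upperInv (√(c R θ d l lam) / 2) ∧
      psi (upperInv (√(c R θ d l lam) / 2)) = √(c R θ d l lam) / 2 := fun lam h => by
    have hm := half_sqrt_c_mem hR hθ hd hdpos le_rfl (hpos.trans_le h.1.1) h.1.2
    exact upperInv_spec hm.1 hm.2
  have hmaps : MapsTo (fun lam => upperInv (√(c R θ d l lam) / 2)) (rootsPlus R θ d l)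
      {u ∈ Ici 1 | HPlusAux R θ d l u = 0} := by
    intro lam h
    refine ⟨(hspec lam h).1, ?_⟩
    have h2 := h.2
    unfold HPlus at h2
    rw [xPlus_eq, Finset.sum_congr rfl fun i _ => by
      rw [xMinus_eq, half_sqrt_c_eq_ratio_mul hdpos l i]] at h2
    unfold HPlusAux
    rw [(hspec lam h).2]
    exact sub_eq_zero.2 h2
  refine Set.Finite.of_injOn hmaps (fun a ha b hb hab => ?_) hfin
  have e : √(c R θ d l a) / 2 = √(c R θ d l b) / 2 := by
    rw [← (hspec a ha).2, ← (hspec b hb).2]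
    exact congrArg psi hab
  rcases lt_trichotomy a b with h | h | h
  · exact absurd e (half_sqrt_c_lt hθ hdpos l (hpos.trans_le ha.1.1) h).ne
  · exact h
  · exact absurd e (half_sqrt_c_lt hθ hdpos l (hpos.trans_le hb.1.1) h).ne'

end roots

/-! ### The number of active layers -/

section layers

variable {K : ℕ} [NeZero K] {R θ : ℝ} {d : Fin K → ℝ}

lemma pos_of_two_le {l : Fin K} (hl : 2 ≤ (l : ℕ) + 1) : 0 < l := by
  rw [Fin.pos_iff_ne_zero]
  rintro rfl
  simp at hl

/-- Clearing denominators and cancelling `2^R` turns the defining inequality of `ellPDS` into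
nonemptiness of the search interval. -/
lemma ellPDS_condition_iff (hθ : 0 < θ) (hdpos : ∀ i, 0 < d i) (i : Fin K) :
    (2 : ℝ) ^ ((((i : ℕ) + 1 : ℕ) : ℝ) * R) / d i ≤
      ((2 : ℝ) ^ R / d 0) * (4 * Real.exp (-2) / (θ ^ 2 * Real.exp (-θ))) ↔
    lamMin θ d ≤ lamMax R θ d i := by
  have hw := weight_pos R i
  have h2R : (0 : ℝ) < 2 ^ R := Real.rpow_pos_of_pos two_pos R
  have hdi := hdpos i
  have hd0 := hdpos 0
  have e : (2 : ℝ) ^ ((((i : ℕ) + 1 : ℕ) : ℝ) * R) = 2 ^ R * weight R i := by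
    unfold weight
    rw [← Real.rpow_add two_pos]
    congr 1
    push_cast
    ring
  have hexp := Real.exp_pos (-θ)
  change _ ↔ d 0 * θ * Real.exp (-θ) ≤ 4 * Real.exp (-2) * d i / (θ * weight R i)
  rw [e, div_mul_div_comm, div_le_div_iff₀ hdi (by positivity), le_div_iff₀ (by positivity),
    show 2 ^ R * weight R i * (d 0 * (θ ^ 2 * Real.exp (-θ))) =
      2 ^ R * (d 0 * θ * Real.exp (-θ) * (θ * weight R i)) by ring,
    show 2 ^ R * (4 * Real.exp (-2)) * d i = 2 ^ R * (4 * Real.exp (-2) * d i) by ring,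
    mul_le_mul_iff_right₀ h2R]

lemma le_ellPDS (hθ : 0 < θ) (hθ2 : θ < 2) (hdpos : ∀ i, 0 < d i) {i : Fin K}
    (h : lamMin θ d ≤ lamMax R θ d i) : (i : ℕ) + 1 ≤ ellPDS R θ d := by
  unfold ellPDS
  rw [if_neg (not_le.2 hθ2)]
  -- The bound `K` matters: without boundedness the supremum in `ℕ` takes the default value `0`.
  refine le_csSup ⟨K, ?_⟩ ⟨i, rfl, (ellPDS_condition_iff hθ hdpos i).2 h⟩
  rintro j ⟨k, rfl, -⟩
  exact k.isLt

lemma lamMin_le_lamMax_zero (hθ : 0 < θ) (hdpos : ∀ i, 0 < d i) :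
    lamMin θ d ≤ lamMax R θ d 0 := by
  have h := mul_le_mul_of_nonneg_right (slope_le hθ one_pos) (hdpos 0).le
  rw [slope_one hθ] at h
  change d 0 * θ * Real.exp (-θ) ≤ 4 * Real.exp (-2) * d 0 / (θ * weight R 0)
  rw [weight_zero, mul_one]
  calc d 0 * θ * Real.exp (-θ) = θ * Real.exp (-θ) * d 0 := by ring
    _ ≤ _ := h
    _ = _ := by ring

lemma one_le_ellPDS (hθ : 0 < θ) (hdpos : ∀ i, 0 < d i) : 1 ≤ ellPDS R θ d := by
  rcases le_or_gt 2 θ with h | h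
  · simp [ellPDS, h]
  · simpa using le_ellPDS hθ h hdpos (lamMin_le_lamMax_zero (R := R) hθ hdpos)

lemma lamMin_le_lamMax (hR : 0 < R) (hθ : 0 < θ) (hd : StrictAnti d) (hdpos : ∀ i, 0 < d i)
    {l : Fin K} (hl : 2 ≤ (l : ℕ) + 1) (hle : (l : ℕ) + 1 ≤ ellPDS R θ d) :
    θ < 2 ∧ lamMin θ d ≤ lamMax R θ d l := by
  have hθ2 : θ < 2 := by
    by_contra! h
    have : ellPDS R θ d = 1 := by simp [ellPDS, h]
    omega
  refine ⟨hθ2, ?_⟩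
  unfold ellPDS at hle
  rw [if_neg (not_le.2 hθ2)] at hle
  set S := {j : ℕ | ∃ i : Fin K, j = (i : ℕ) + 1 ∧ (2 : ℝ) ^ ((j : ℝ) * R) / d i ≤
      ((2 : ℝ) ^ R / d 0) * (4 * Real.exp (-2) / (θ ^ 2 * Real.exp (-θ)))} with hS
  have hbdd : BddAbove S := by
    refine ⟨K, ?_⟩
    rintro j ⟨k, rfl, -⟩
    exact k.isLt
  have hne : S.Nonempty :=
    ⟨_, 0, rfl, (ellPDS_condition_iff hθ hdpos 0).2 (lamMin_le_lamMax_zero hθ hdpos)⟩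
  -- The supremum is attained at some layer `i`; as `lamMax` decreases with the layer, the condition
  -- passes down to every `l ≤ i`.
  obtain ⟨i, hi, hcond⟩ := Nat.sSup_mem hne hbdd
  rw [hi] at hcond hle
  exact ((ellPDS_condition_iff hθ hdpos i).1 hcond).trans
    (antitone_lamMax hR hθ hd hdpos (Fin.le_def.2 (by omega)))

lemma testArg_spec (hK : 2 ≤ K) (hR : 0 < R) (hd : StrictAnti d) (hdpos : ∀ i, 0 < d i) :
    1 / Real.exp 1 * √(d 1 / ((2 : ℝ) ^ R * d 0)) ∈ Ioo 0 (Real.exp (-1)) := by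
  have h2R : (1 : ℝ) < 2 ^ R := Real.one_lt_rpow one_lt_two hR
  have hd0 := hdpos 0
  have hd1 := hdpos 1
  have hval : ((1 : Fin K) : ℕ) = 1 := by
    rw [Fin.val_one']
    exact Nat.mod_eq_of_lt hK
  have hlt : d 1 < d 0 := hd (Fin.lt_def.2 (by rw [hval]; simp))
  have h1 : √(d 1 / ((2 : ℝ) ^ R * d 0)) < 1 := by
    rw [Real.sqrt_lt' one_pos, one_pow, div_lt_one (by positivity)]
    nlinarith
  have h2 : 1 / Real.exp 1 = Real.exp (-1) := by rw [Real.exp_neg, one_div]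
  rw [h2]
  refine ⟨by positivity, ?_⟩
  exact mul_lt_of_lt_one_right (Real.exp_pos _) h1

/-- For `θ < 2` the argument `θ/2` lies where `psi` increases, so the test becomes `s < psi (θ/2)`.
Squared, this says that `lamMin` exceeds `lamMax` for two layers, contradicting the presence of a
layer `l ≥ 1` within `ellPDS`. -/
lemma initialTest_ellPDS (hK : 2 ≤ K) (hR : 0 < R) (hθ : 0 < θ) (hd : StrictAnti d)
    (hdpos : ∀ i, 0 < d i) (htest : initialTest R θ d) {l : Fin K} (hl : 2 ≤ (l : ℕ) + 1)
    (hle : (l : ℕ) + 1 ≤ ellPDS R θ d) : False := by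
  obtain ⟨hθ2, hlam⟩ := lamMin_le_lamMax hR hθ hd hdpos hl hle
  have hval : ((1 : Fin K) : ℕ) = 1 := by
    rw [Fin.val_one']
    exact Nat.mod_eq_of_lt hK
  have hlam1 : lamMin θ d ≤ lamMax R θ d 1 :=
    hlam.trans (antitone_lamMax hR hθ hd hdpos (Fin.le_def.2 (by omega)))
  have hs := testArg_spec (R := R) hK hR hd hdpos
  set s := 1 / Real.exp 1 * √(d 1 / ((2 : ℝ) ^ R * d 0)) with hs_def
  have hL := lowerInv_spec hs.1 hs.2.le
  have ht : lowerInv s < θ / 2 := by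
    have : θ > -2 * lambertW0 (-s) := htest
    unfold lowerInv
    linarith
  have hlt : s < psi (θ / 2) := by
    rw [← hL.2]
    exact strictMonoOn_psi hL.1.2 (mem_Iic.2 (by linarith)) ht
  have hsq : s ^ 2 < psi (θ / 2) ^ 2 := by
    have := hs.1
    gcongr
  have hd0 := hdpos 0
  have hd1 := hdpos 1
  have h2R : (0 : ℝ) < 2 ^ R := Real.rpow_pos_of_pos two_pos R
  have hw : weight R (1 : Fin K) = 2 ^ R := by unfold weight; rw [hval, Nat.cast_one, mul_one]
  have e1 : s ^ 2 = Real.exp (-2) * (d 1 / (2 ^ R * d 0)) := by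
    rw [hs_def, mul_pow, Real.sq_sqrt (by positivity), one_div, ← Real.exp_neg,
      ← Real.exp_nat_mul]
    norm_num
  have e2 : psi (θ / 2) ^ 2 = θ ^ 2 / 4 * Real.exp (-θ) := by
    unfold psi
    rw [mul_pow, ← Real.exp_nat_mul]
    ring_nf
  rw [e1, e2, ← mul_div_assoc, div_lt_iff₀ (by positivity)] at hsq
  have h3 : d 0 * θ * Real.exp (-θ) ≤ 4 * Real.exp (-2) * d 1 / (θ * weight R 1) := hlam1
  rw [hw, le_div_iff₀ (by positivity)] at h3
  linarith

end layers

/-! ### Form of the maximizers and correctness of the algorithm -/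

section main

variable {K : ℕ} [NeZero K] {R θ : ℝ} {d x : Fin K → ℝ}

lemma IsGlobalMaximizer.eq_firstVec_or_hasLambertForm (hx : IsGlobalMaximizer R θ d x)
    (hR : 0 < R) (hθ : 0 < θ) (hd : StrictAnti d) (hdpos : ∀ i, 0 < d i) :
    x = firstVec K ∨ HasLambertForm R θ d x := by
  obtain ⟨hs, hn⟩ := mem_feasible.1 hx.1
  have hanti := hx.antitone hR hθ hd hdpos
  by_cases hall : ∀ k, k ≠ 0 → x k = 0
  · left
    rw [Finset.sum_eq_single 0 (fun k _ hk => by rw [hall k hk, mul_zero]) (by simp),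
      weight_zero, one_mul] at hs
    funext k
    by_cases hk : k = 0
    · subst hk; simp [firstVec, hs]
    · simp [firstVec, hk, hall k hk]
  · right
    push Not at hall
    obtain ⟨k, hk0, hk⟩ := hall
    classical
    let A : Finset (Fin K) := Finset.univ.filter fun i => 0 < x i
    have hkA : k ∈ A := by simpa [A] using lt_of_le_of_ne (hn k) hk.symm
    set l := A.max' ⟨k, hkA⟩ with hl_def
    have hlpos : 0 < x l := by simpa [A] using A.max'_mem ⟨k, hkA⟩
    have hl0 : 0 < l := (Fin.pos_iff_ne_zero.2 hk0).trans_le (A.le_max' k hkA)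
    have htail : ∀ i > l, x i = 0 := by
      intro i hi
      by_contra h
      have : i ∈ A := by simpa [A] using lt_of_le_of_ne (hn i) (Ne.symm h)
      exact absurd (A.le_max' i this) (not_le.2 hi)
    have hpos : ∀ i ≤ l, 0 < x i := fun i hi => hlpos.trans_le (hanti hi)
    have hhalf : ∀ i < l, θ / 2 ≤ x i := by
      intro i hi
      by_contra! h
      -- By monotonicity the last active coordinate is no larger than `x i`, so both would lie in
      -- the convex region.
      exact hx.not_both_lt hθ hdpos hi.ne ⟨hpos i hi.le, h⟩ ⟨hlpos, (hanti hi.le).trans_lt h⟩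
    have hsum : ∑ i ∈ Finset.Iic l, weight R i * x i = 1 := by
      rw [← hs]
      refine Finset.sum_subset (Finset.subset_univ _) fun i _ hi => ?_
      rw [htail i (not_le.1 fun h => hi (Finset.mem_Iic.2 h)), mul_zero]
    set lam := slope θ (x l) * d l / weight R l with hlam_def
    have hlam : ∀ i ≤ l, slope θ (x i) * d i / weight R i = lam := by
      intro i hi
      rcases hi.eq_or_lt with rfl | hi
      · rfl
      · exact hx.slope_eq hθ hdpos hi.ne (hpos i hi.le) hlpos
    have hx0 : x 0 < 1 := by
      have h1 : weight R (0 : Fin K) * x 0 + weight R l * x l ≤ ∑ i, weight R i * x i := by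
        rw [← Finset.sum_pair (f := fun i => weight R i * x i) hl0.ne]
        exact Finset.sum_le_sum_of_subset_of_nonneg (Finset.subset_univ _)
          fun i _ _ => mul_nonneg (weight_pos R i).le (hn i)
      rw [hs, weight_zero] at h1
      nlinarith [mul_pos (weight_pos R l) hlpos]
    have hmin : lamMin θ d ≤ lam := by
      have h1 := slope_antitoneOn hθ (mem_Ici.2 (hhalf 0 hl0))
        (mem_Ici.2 ((hhalf 0 hl0).trans hx0.le)) hx0.le
      rw [slope_one hθ] at h1
      rw [← hlam 0 hl0.le, weight_zero, div_one]
      have h2 := mul_le_mul_of_nonneg_right h1 (hdpos 0).le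
      unfold lamMin
      linarith
    have hmax : lam ≤ lamMax R θ d l := by
      have h1 := mul_le_mul_of_nonneg_right (slope_le hθ hlpos) (hdpos l).le
      have hw := weight_pos R l
      calc lam ≤ 4 * Real.exp (-2) / θ * d l / weight R l := by
            rw [hlam_def]
            gcongr
        _ = lamMax R θ d l := by
            change _ = 4 * Real.exp (-2) * d l / (θ * weight R l)
            field_simp
    have hl1 : 2 ≤ (l : ℕ) + 1 := by
      have : 0 < (l : ℕ) := by simpa using Fin.lt_def.1 hl0
      omega
    refine ⟨l, hl1, le_ellPDS hθ (by linarith [hhalf 0 hl0]) hdpos (hmin.trans hmax), lam,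
      ⟨hmin, hmax⟩, fun i hi => (xMinus_of_slope hθ hdpos (hhalf i hi) (hlam i hi.le)).symm,
      ?_, htail, hsum⟩
    rcases le_total (θ / 2) (x l) with h | h
    · exact Or.inl (xMinus_of_slope hθ hdpos h rfl).symm
    · exact Or.inr (xPlus_of_slope hθ hdpos hlpos h rfl).symm

lemma HasLambertForm.exists_mem_candidates (h : HasLambertForm R θ d x) (hR : 0 < R)
    (hθ : 0 < θ) (hd : StrictAnti d) (hdpos : ∀ i, 0 < d i) :
    ∃ l : Fin K, 2 ≤ (l : ℕ) + 1 ∧ (l : ℕ) + 1 ≤ ellPDS R θ d ∧ x ∈ candidates R θ d l := by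
  obtain ⟨l, hl, hle, lam, hlam, hbefore, hat, hafter, hsum⟩ := h
  have hmin : 0 < lamMin θ d := lamMin_pos hθ hdpos
  have hpos : 0 < lam := hmin.trans_le hlam.1
  have hminmax := hlam.1.trans hlam.2
  have hH := (strictAntiOn_HMinus hR hθ hd hdpos l).antitoneOn
  refine ⟨l, hl, hle, ?_⟩
  rcases hat with hat | hat
  · have hroot : HMinus R θ d l lam = 1 := by
      rw [← hsum]
      refine Finset.sum_congr rfl fun i hi => ?_
      rcases (Finset.mem_Iic.1 hi).eq_or_lt with rfl | hi
      · rw [hat]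
      · rw [hbefore i hi]
    refine Or.inl ⟨⟨?_, ?_⟩, lam, ⟨hlam, hroot⟩, ?_⟩
    · exact hroot.symm.le.trans (hH ⟨hmin, hminmax⟩ ⟨hpos, hlam.2⟩ hlam.1)
    · exact (hH ⟨hpos, hlam.2⟩ ⟨hmin.trans_le hminmax, le_rfl⟩ hlam.2).trans hroot.le
    · funext i
      unfold candMinus
      split_ifs with hi
      · rcases hi.eq_or_lt with rfl | hi
        · exact hat
        · exact hbefore i hi
      · exact hafter i (not_le.1 hi)
  · have hroot : HPlus R θ d l lam = 1 := by
      rw [← hsum, Iic_sum_eq, hat]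
      unfold HPlus
      congr 1
      exact Finset.sum_congr rfl fun i hi => by rw [hbefore i (Finset.mem_Iio.1 hi)]
    refine Or.inr ⟨?_, lam, ⟨hlam, hroot⟩, ?_⟩
    · exact (hroot.symm.le.trans (HPlus_le_HMinus hR hθ hd hdpos l hpos hlam.2)).trans
        (hH ⟨hmin, hminmax⟩ ⟨hpos, hlam.2⟩ hlam.1)
    · funext i
      unfold candPlus
      split_ifs with hi hi'
      · exact hbefore i hi
      · subst hi'; exact hat
      · exact hafter i (lt_of_le_of_ne (not_lt.1 hi) (Ne.symm hi'))

lemma candidates_subset_feasible (hR : 0 < R) (hθ : 0 < θ) (hd : StrictAnti d)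
    (hdpos : ∀ i, 0 < d i) (l : Fin K) : candidates R θ d l ⊆ feasible K R := by
  have hmin : 0 < lamMin θ d := lamMin_pos hθ hdpos
  have hsplit : ∀ y : Fin K → ℝ, (∀ i > l, y i = 0) →
      ∑ i, weight R i * y i = ∑ i ∈ Finset.Iic l, weight R i * y i := by
    intro y hy
    refine (Finset.sum_subset (Finset.subset_univ _) fun i _ hi => ?_).symm
    rw [hy i (not_le.1 fun h => hi (Finset.mem_Iic.2 h)), mul_zero]
  rintro x (⟨-, lam, ⟨hlam, hroot⟩, rfl⟩ | ⟨-, lam, ⟨hlam, hroot⟩, rfl⟩)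
  · refine mem_feasible.2 ⟨?_, fun i => ?_⟩
    · rw [hsplit _ fun i hi => by rw [candMinus, if_neg (not_le.2 hi)], ← hroot]
      exact Finset.sum_congr rfl fun i hi => by
        rw [candMinus, if_pos (Finset.mem_Iic.1 hi)]; rfl
    · unfold candMinus
      split_ifs with hi
      · linarith [half_le_xMinus hR hθ hd hdpos hi (hmin.trans_le hlam.1) hlam.2]
      · exact le_rfl
  · refine mem_feasible.2 ⟨?_, fun i => ?_⟩
    · rw [hsplit _ fun i hi => by rw [candPlus, if_neg (not_lt.2 hi.le), if_neg hi.ne'],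
        ← hroot, Iic_sum_eq]
      unfold HPlus
      congr 1
      · rw [candPlus, if_neg (lt_irrefl l), if_pos rfl]; rfl
      · exact Finset.sum_congr rfl fun i hi => by
          rw [candPlus, if_pos (Finset.mem_Iio.1 hi)]; rfl
    · unfold candPlus
      split_ifs with hi hi'
      · linarith [half_le_xMinus hR hθ hd hdpos hi.le (hmin.trans_le hlam.1) hlam.2]
      · exact (xPlus_mem hR hθ hd hdpos hi'.le (hmin.trans_le hlam.1) hlam.2).1.le
      · exact le_rfl

lemma finite_candidates (hR : 0 < R) (hθ : 0 < θ) (hd : StrictAnti d) (hdpos : ∀ i, 0 < d i)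
    {l : Fin K} (hl : 2 ≤ (l : ℕ) + 1) (hle : (l : ℕ) + 1 ≤ ellPDS R θ d) :
    (candidates R θ d l).Finite := by
  have hl0 : 0 < l := pos_of_two_le hl
  refine Set.Finite.union ?_ ?_
  · by_cases hg : guardMinus R θ d l
    · obtain ⟨lam, -, huniq⟩ := existsUnique_rootsMinus hR hθ hd hdpos
        (lamMin_le_lamMax hR hθ hd hdpos hl hle).2 hg
      refine (Set.finite_singleton (candMinus R θ d l lam)).subset ?_
      rintro y ⟨-, mu, hmu, rfl⟩
      rw [huniq mu hmu]
      rfl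
    · refine Set.finite_empty.subset ?_
      rintro y ⟨h, -⟩
      exact hg h
  · refine ((finite_rootsPlus hR hθ hd hdpos hl0).image (candPlus R θ d l)).subset ?_
    rintro y ⟨-, mu, hmu, rfl⟩
    exact ⟨mu, hmu, rfl⟩

lemma algorithmWellDefined (hK : 2 ≤ K) (hR : 0 < R) (hθ : 0 < θ) (hd : StrictAnti d)
    (hdpos : ∀ i, 0 < d i) : AlgorithmWellDefined R θ d := by
  have he : 1 / Real.exp 1 = Real.exp (-1) := by rw [Real.exp_neg, one_div]
  refine ⟨?_, fun l hl hle => ?_⟩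
  · have h := testArg_spec hK hR hd hdpos
    rw [testArg]
    exact ⟨by linarith [h.2], by linarith [h.1]⟩
  · have hlam := (lamMin_le_lamMax hR hθ hd hdpos hl hle).2
    refine ⟨hlam, fun lam hm i hi => ?_, existsUnique_rootsMinus hR hθ hd hdpos hlam,
      finite_rootsPlus hR hθ hd hdpos (pos_of_two_le hl)⟩
    have h := half_sqrt_c_mem hR hθ hd hdpos hi ((lamMin_pos hθ hdpos).trans_le hm.1) hm.2
    rw [he]
    exact ⟨by linarith [h.2], by linarith [h.1]⟩

lemma exists_isAlgorithmOutput (hR : 0 < R) (hθ : 0 < θ) (hd : StrictAnti d)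
    (hdpos : ∀ i, 0 < d i) : ∃ x, IsAlgorithmOutput R θ d x := by
  by_cases htest : initialTest R θ d
  · exact ⟨_, Or.inl ⟨htest, rfl⟩⟩
  have hex : ∀ l : Fin K, ∃ y, (l = 0 → y = firstVec K) ∧
      (2 ≤ (l : ℕ) + 1 → (l : ℕ) + 1 ≤ ellPDS R θ d → IsLayerPoint R θ d l y) := by
    intro l
    by_cases hl : 2 ≤ (l : ℕ) + 1 ∧ (l : ℕ) + 1 ≤ ellPDS R θ d
    · have hl0 : l ≠ 0 := by
        rintro rfl
        simp at hl
      rcases (candidates R θ d l).eq_empty_or_nonempty with he | hne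
      · exact ⟨0, fun h => absurd h hl0, fun _ _ => Or.inl ⟨he, rfl⟩⟩
      · obtain ⟨y, hy, hmax⟩ := Set.exists_max_image _ (G θ d)
          (finite_candidates hR hθ hd hdpos hl.1 hl.2) hne
        exact ⟨y, fun h => absurd h hl0, fun _ _ => Or.inr ⟨hy, hmax⟩⟩
    -- Layer `0` needs this value; layers beyond `ellPDS` are never consulted, so it is mere filler
    -- there.
    · exact ⟨firstVec K, fun _ => rfl, fun h1 h2 => absurd ⟨h1, h2⟩ hl⟩
  choose p hp0 hp using hex
  obtain ⟨l, hl, hmax⟩ := Set.exists_max_image {l : Fin K | (l : ℕ) + 1 ≤ ellPDS R θ d}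
    (fun l => G θ d (p l)) (Set.toFinite _)
    ⟨0, by
      simpa [Nat.one_le_iff_ne_zero, Nat.pos_iff_ne_zero] using one_le_ellPDS (R := R) hθ hdpos⟩
  exact ⟨p l, Or.inr ⟨htest, p, hp0 0 rfl, hp, l, hl, rfl, fun j hj => hmax j hj⟩⟩

lemma IsAlgorithmOutput.isGlobalMaximizer (hx : IsAlgorithmOutput R θ d x) (hK : 2 ≤ K)
    (hR : 0 < R) (hθ : 0 < θ) (hd : StrictAnti d) (hdpos : ∀ i, 0 < d i) :
    IsGlobalMaximizer R θ d x := by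
  obtain ⟨z, hz⟩ := exists_isGlobalMaximizer R hθ d
  have hform := hz.eq_firstVec_or_hasLambertForm hR hθ hd hdpos
  rcases hx with ⟨htest, rfl⟩ | ⟨-, p, hp0, hp, l, hl, rfl, hmax⟩
  · rcases hform with rfl | ⟨l, hl, hle, -⟩
    · exact hz
    · exact (initialTest_ellPDS hK hR hθ hd hdpos htest hl hle).elim
  · have h1 : ((0 : Fin K) : ℕ) + 1 ≤ ellPDS R θ d := by
      simpa using one_le_ellPDS (R := R) hθ hdpos
    have hGz : G θ d z ≤ G θ d (p l) := by
      rcases hform with rfl | h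
      · rw [← hp0]
        exact hmax 0 h1
      · obtain ⟨m, hm, hme, hmem⟩ := h.exists_mem_candidates hR hθ hd hdpos
        refine le_trans ?_ (hmax m hme)
        rcases hp m hm hme with ⟨he, -⟩ | ⟨-, hbest⟩
        · rw [he] at hmem
          exact hmem.elim
        · exact hbest z hmem
    refine ⟨?_, fun y hy => (hz.2 y hy).trans hGz⟩
    by_cases hl0 : l = 0
    · rw [hl0, hp0]
      exact firstVec_mem_feasible K R
    · have hl2 : 2 ≤ (l : ℕ) + 1 := by
        have := Fin.val_ne_of_ne hl0
        simp only [Fin.val_zero] at this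
        omega
      rcases hp l hl2 hl with ⟨-, hzero⟩ | ⟨hmem, -⟩
      · have h2 := hmax 0 h1
        rw [hp0, hzero, G_firstVec] at h2
        have h3 : G θ d (0 : Fin K → ℝ) = 0 := by simp [G, g]
        have h4 := mul_pos (Real.exp_pos (-θ)) (hdpos 0)
        linarith
      · exact candidates_subset_feasible hR hθ hd hdpos l hmem

end main

end PDS

theorem mainTheorem7 (K : ℕ) [NeZero K] (hK : 2 ≤ K) (R θ : ℝ) (hR : 0 < R) (hθ : 0 < θ)
    (d : Fin K → ℝ) (hd : StrictAnti d) (hdpos : ∀ i, 0 < d i) :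
    PDS.AlgorithmWellDefined R θ d ∧
    (∃ x, PDS.IsAlgorithmOutput R θ d x) ∧
    (∀ x, PDS.IsAlgorithmOutput R θ d x → PDS.IsGlobalMaximizer R θ d x) ∧
    (∀ x, PDS.IsGlobalMaximizer R θ d x → x = PDS.firstVec K ∨ PDS.HasLambertForm R θ d x) :=
  ⟨PDS.algorithmWellDefined hK hR hθ hd hdpos, PDS.exists_isAlgorithmOutput hR hθ hd hdpos,
    fun _ hx => hx.isGlobalMaximizer hK hR hθ hd hdpos,
    fun _ hx => hx.eq_firstVec_or_hasLambertForm hR hθ hd hdpos⟩
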